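/- Let $R$ be a commutative ring with $1$, let $V$ be a free $R$-module with basis $e_1,\dots,e_n$, and let $E=\Lambda V$ be its exterior algebra, with $E_q=\Lambda^qV$. For $S=\{i_1<\dots<i_q\}\subseteq[n]=\{1,\dots,n\}$ put $e_S=e_{i_1}\cdots e_{i_q}$, and let $\partial:E\to E$ be the $R$-linear map of degree $-1$ with $\partial e_i=1$ for all $i$ and $\partial(ab)=(\partial a)b+(-1)^{\deg a}a\,\partial b$ for homogeneous $a$ and all $b$. Let $M$ be a simple matroid on $[n]$ (no loops and no two distinct parallel elements), with closure operator $\mathrm{cl}$. Let $I$ be the ideal of $E$ generated by all $\partial e_S$ with $S$ dependent in $M$, let $I^0=\{a\in E : ab=0\text{ for every }b\in I\}$, and put $(I^0)_q=I^0\cap E_q$. A broken circuit is a circuit of $M$ with its smallest element deleted, and $T\subseteq[n]$ is an nbc-set if it contains no broken circuit. For an nbc-set $T=\{i_1<\dots<i_p\}$ put $X_k=\mathrm{cl}(\{i_{p-k+1},\dots,i_p\})$ for $0\le k\le p$ (so $X_0=\emptyset$), $S_k=X_k\setminus X_{k-1}$ for $1\le k\le p$, and $$z(T)=\mathrm{sign}(\sigma)\,\partial(e_{S_1})\,\partial(e_{S_2})\cdots\partial(e_{S_p})\,e_{[n]\setminus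 X_p},$$ where $\sigma$ is the permutation of $[n]$ that lists the elements of $S_1$, then those of $S_2,\dots,S_p$, then those of $[n]\setminus X_p$, each set in increasing order. Then, for every $p$ with $0\le p\le n$, the family $(z(T))_T$, indexed by the nbc-sets $T$ of cardinality $p$, is an $R$-basis of $(I^0)_{n-p}$; in particular $(I^0)_{n-p}$ is a free $R$-module. -/

import Mathlib

namespace OrlikSolomon

noncomputable section

/-! ### Matroid notions on `[n]`, modelled as `Fin n` with its linear order -/

/-- A matroid with neither loops nor pairs of distinct parallel elements
(the case `i = j` says that `i` is not a loop). -/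
def IsSimple {n : ℕ} (M : Matroid (Fin n)) : Prop :=
  ∀ i ∈ M.E, ∀ j ∈ M.E, M.Indep {i, j}

/-- A broken circuit: a circuit with its smallest element deleted. -/
def IsBrokenCircuit {n : ℕ} (M : Matroid (Fin n)) (B : Set (Fin n)) : Prop :=
  ∃ (C : Set (Fin n)) (i : Fin n), M.IsCircuit C ∧ IsLeast C i ∧ B = C \ {i}

/-- An nbc-set: a set that contains no broken circuit. -/
def IsNBC {n : ℕ} (M : Matroid (Fin n)) (T : Finset (Fin n)) : Prop :=
  ∀ B : Set (Fin n), IsBrokenCircuit M B → ¬ B ⊆ T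

/-- The flat `X_k` of the flag of `T = {i_1 < ... < i_p}`: the closure of the last `k` elements
`i_{p-k+1}, ..., i_p` of `T`, for `0 ≤ k ≤ p`. -/
def flagFlat {n : ℕ} (M : Matroid (Fin n)) (T : Finset (Fin n)) (k : ℕ) : Set (Fin n) :=
  M.closure {i | i ∈ (T.sort (· ≤ ·)).drop (T.card - k)}

open Classical in
/-- The ordered list of blocks `S_1, ..., S_p` of the flag of `T`, where
`S_k = X_k \ X_{k-1}`. -/
def flagBlocks {n : ℕ} (M : Matroid (Fin n)) (T : Finset (Fin n)) : List (Finset (Fin n)) :=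
  (List.range T.card).map fun k =>
    Finset.univ.filter fun i => i ∈ flagFlat M T (k + 1) \ flagFlat M T k

/-- The elements of `[n]` that lie in none of the listed blocks. -/
def remainder {n : ℕ} (L : List (Finset (Fin n))) : Finset (Fin n) :=
  Finset.univ.filter fun i => ∀ A ∈ L, i ∉ A

/-- For pairwise disjoint blocks `A_1, ..., A_k`, the permutation of `[n]` that lists the elements
of `A_1` first, then those of `A_2`, and so on, and the elements in no block last, each group in
increasing order. (`findIdx` gives the position of the block containing `i`, and the length of the
list if there is none; `Tuple.sort` sorts by this key and breaks ties by the order of `[n]`.) -/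
def shuffle {n : ℕ} (L : List (Finset (Fin n))) : Equiv.Perm (Fin n) :=
  Tuple.sort fun i => L.findIdx fun A => decide (i ∈ A)

/-! ### The exterior algebra on a free module `V` with basis `e` indexed by `[n]` -/

variable {R : Type*} [CommRing R] {V : Type*} [AddCommGroup V] [Module R V] {n : ℕ}

/-- The monomial `e_S = e_{i_1} ⋯ e_{i_p}` for `S = {i_1 < ... < i_p}`. -/
def monomial (e : Module.Basis (Fin n) R V) (S : Finset (Fin n)) : ExteriorAlgebra R V :=
  ((S.sort (· ≤ ·)).map fun i => ExteriorAlgebra.ι R (e i)).prod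

/-- The differential `∂` of degree `-1`: the antiderivation with `∂ e_i = 1` for all `i`, that is,
contraction with the linear form taking the value `1` on every basis vector. -/
def differential (e : Module.Basis (Fin n) R V) :
    ExteriorAlgebra R V →ₗ[R] ExteriorAlgebra R V :=
  CliffordAlgebra.contractLeft (Q := (0 : QuadraticForm R V)) (e.constr R fun _ => (1 : R))

theorem differential_one (e : Module.Basis (Fin n) R V) : differential e 1 = 0 :=
  CliffordAlgebra.contractLeft_one (Q := (0 : QuadraticForm R V)) _

theorem differential_ι (e : Module.Basis (Fin n) R V) (i : Fin n) :
    differential e (ExteriorAlgebra.ι R (e i)) = 1 := by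
  have h := CliffordAlgebra.contractLeft_ι (Q := (0 : QuadraticForm R V))
    (d := e.constr R fun _ => (1 : R)) (e i)
  rw [Module.Basis.constr_basis, map_one] at h
  exact h

/-- The Leibniz rule for a left factor of degree one. Together with `∂ 1 = 0` it determines `∂`. -/
theorem differential_ι_mul (e : Module.Basis (Fin n) R V) (i : Fin n)
    (x : ExteriorAlgebra R V) :
    differential e (ExteriorAlgebra.ι R (e i) * x) =
      x - ExteriorAlgebra.ι R (e i) * differential e x := by
  have h := CliffordAlgebra.contractLeft_ι_mul (Q := (0 : QuadraticForm R V))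
    (d := e.constr R fun _ => (1 : R)) (e i) x
  rw [Module.Basis.constr_basis, one_smul] at h
  exact h

/-- The Orlik-Solomon ideal: the two-sided ideal generated by `∂ e_S` for all dependent `S`. -/
def ideal (e : Module.Basis (Fin n) R V) (M : Matroid (Fin n)) :
    TwoSidedIdeal (ExteriorAlgebra R V) :=
  TwoSidedIdeal.span {x | ∃ S : Finset (Fin n), M.Dep S ∧ x = differential e (monomial e S)}

/-- The annihilator `I⁰ = {a | a b = 0 for every b ∈ I}`, as an `R`-submodule. -/
def annihilator (I : TwoSidedIdeal (ExteriorAlgebra R V)) :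
    Submodule R (ExteriorAlgebra R V) where
  carrier := {a | ∀ b ∈ I, a * b = 0}
  zero_mem' := fun b _ => zero_mul b
  add_mem' := fun {x y} hx hy b hb => by rw [add_mul, hx b hb, hy b hb, add_zero]
  smul_mem' := fun r x hx b hb => by rw [smul_mul_assoc, hx b hb, smul_zero]

/-- The component `(I⁰)_q = I⁰ ∩ E_q` of degree `q` of the annihilator. -/
def annihilatorComponent (I : TwoSidedIdeal (ExteriorAlgebra R V)) (q : ℕ) :
    Submodule R (ExteriorAlgebra R V) :=
  annihilator I ⊓ ⋀[R]^q V

/-- For an ordered partition `A_1, ..., A_k` of a subset `X` of `[n]`, the element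
`sign(σ) ∂(e_{A_1}) ⋯ ∂(e_{A_k}) e_{[n] \ X}`, with `σ` the shuffle of `A_1, ..., A_k, [n] \ X`. -/
def zBlocks (e : Module.Basis (Fin n) R V) (L : List (Finset (Fin n))) : ExteriorAlgebra R V :=
  (Equiv.Perm.sign (shuffle L) : ℤ) •
    ((L.map fun A => differential e (monomial e A)).prod * monomial e (remainder L))

/-- The element `z(T)`, formed from the blocks `S_1, ..., S_p` of the flag of `T`. -/
def z (e : Module.Basis (Fin n) R V) (M : Matroid (Fin n)) (T : Finset (Fin n)) :
    ExteriorAlgebra R V :=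
  zBlocks e (flagBlocks M T)

end

end OrlikSolomon

/-! The elements z(T) are dual, up to sign, to the monomials of nbc-sets under the perfect pairing
E_{n-p} × E_p → E_n ≅ R given by multiplication. All identities are therefore needed only up to
sign.

Membership in I⁰: if s, t ∈ S are distinct, then e_s - e_t divides ∂e_S. Hence z(T) is killed by e_s
- e_t whenever s, t lie in one block of the flag, or both outside X_p. A set with no such pair is
built up through the flats X_k by adding at most one element outside a flat each time, so it is
independent. A dependent S thus contains such a pair, and z(T)∂e_S = 0.

Duality: z(T)e_T is ± the top monomial, because e_i ∂e_A = e_A for i ∈ A. If z(T)e_U ≠ 0 with |U| =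
p, then U is a transversal of the layers of T. For nbc-sets this forces U = T
(`IsNBC.eq_of_transversal`), which gives linear independence.

Spanning: subtracting a combination of the z(T) from a ∈ (I⁰)_{n-p} leaves c ∈ I⁰ that kills e_U for
every nbc-set U of size p. Straightening modulo I (`mul_monomial_eq_zero_of_forall_nbc`) shows that
c kills every e_S with |S| = p, so c = 0 by nondegeneracy of the pairing. -/

namespace OrlikSolomon

open ExteriorAlgebra

/-! ### Exterior algebra: signs, divisibility, degrees, duality -/

section Exterior

variable {R : Type*} [CommRing R] {V : Type*} [AddCommGroup V] [Module R V] {n : ℕ}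

/-! ### Signs and monomials of lists -/

/-- Two elements that agree up to sign. -/
def EqUpToSign {A : Type*} [Neg A] (x y : A) : Prop := x = y ∨ x = -y

namespace EqUpToSign

variable {A : Type*} [Ring A] {x y w u v : A}

theorem refl (x : A) : EqUpToSign x x := Or.inl rfl

theorem symm (h : EqUpToSign x y) : EqUpToSign y x := by
  rcases h with rfl | rfl
  · exact Or.inl rfl
  · exact Or.inr (neg_neg _).symm

theorem trans (h : EqUpToSign x y) (h' : EqUpToSign y w) : EqUpToSign x w := by
  rcases h with rfl | rfl <;> rcases h' with rfl | rfl <;> simp [EqUpToSign]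

theorem mul (h : EqUpToSign x y) (h' : EqUpToSign u v) : EqUpToSign (x * u) (y * v) := by
  rcases h with rfl | rfl <;> rcases h' with rfl | rfl <;> simp [EqUpToSign]

theorem eq_zero (h : EqUpToSign x y) (hy : y = 0) : x = 0 := by
  rcases h with rfl | rfl <;> simp [hy]

end EqUpToSign

/-- The product `e_{i_1} ⋯ e_{i_k}` along a list of indices. -/
noncomputable def listMonomial (e : Module.Basis (Fin n) R V) (l : List (Fin n)) :
    ExteriorAlgebra R V :=
  (l.map fun i => ι R (e i)).prod

variable (e : Module.Basis (Fin n) R V)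

@[simp]
theorem listMonomial_nil : listMonomial e [] = 1 := rfl

@[simp]
theorem listMonomial_cons (i : Fin n) (l : List (Fin n)) :
    listMonomial e (i :: l) = ι R (e i) * listMonomial e l := by
  simp [listMonomial]

@[simp]
theorem listMonomial_append (l l' : List (Fin n)) :
    listMonomial e (l ++ l') = listMonomial e l * listMonomial e l' := by
  simp [listMonomial]

theorem monomial_eq_listMonomial (S : Finset (Fin n)) :
    monomial e S = listMonomial e (S.sort (· ≤ ·)) := rfl

theorem ι_mul_ι_eq_neg (v w : V) : ι R v * ι R w = -(ι R w * ι R v) :=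
  eq_neg_of_add_eq_zero_left (ι_add_mul_swap v w)

theorem listMonomial_perm {l l' : List (Fin n)} (h : l.Perm l') :
    EqUpToSign (listMonomial e l) (listMonomial e l') := by
  induction h with
  | nil => exact .refl _
  | cons i _ ih => simpa using (EqUpToSign.refl _).mul ih
  | swap i j l =>
    refine Or.inr ?_
    rw [listMonomial_cons, listMonomial_cons, listMonomial_cons, listMonomial_cons, ← mul_assoc,
      ι_mul_ι_eq_neg, neg_mul, mul_assoc]
  | trans _ _ h₁ h₂ => exact h₁.trans h₂

theorem monomial_toFinset {l : List (Fin n)} (hl : l.Nodup) :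
    EqUpToSign (monomial e l.toFinset) (listMonomial e l) :=
  listMonomial_perm e ((List.perm_ext_iff_of_nodup (Finset.sort_nodup _ _) hl).2 (by simp))

/-! ### Annihilation by vectors -/

/-- If a vector kills `x` from the right, it kills the right ideal generated by `x`. -/
theorem mul_mul_ι_eq_zero {x : ExteriorAlgebra R V} {v : V} (hx : x * ι R v = 0)
    (y : ExteriorAlgebra R V) : x * y * ι R v = 0 := by
  induction y using ExteriorAlgebra.induction generalizing x with
  | algebraMap r => rw [mul_assoc, Algebra.commutes, ← mul_assoc, hx, zero_mul]
  | ι w => rw [mul_assoc, ι_mul_ι_eq_neg, mul_neg, ← mul_assoc, hx, zero_mul, neg_zero]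
  | mul a b ha hb => rw [← mul_assoc]; exact hb (ha hx)
  | add a b ha hb => rw [mul_add, add_mul, ha hx, hb hx, add_zero]

theorem ι_mul_mul_ι_eq_zero (v : V) (y : ExteriorAlgebra R V) : ι R v * y * ι R v = 0 :=
  mul_mul_ι_eq_zero (ι_sq_zero v) y

theorem exists_monomial_eq_ι_mul {S : Finset (Fin n)} {s : Fin n} (hs : s ∈ S) :
    ∃ y, monomial e S = ι R (e s) * y := by
  have h := listMonomial_perm e (List.perm_cons_erase ((Finset.mem_sort (· ≤ ·)).2 hs))
  rw [listMonomial_cons] at h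
  rcases h with h | h
  · exact ⟨_, h⟩
  · exact ⟨_, h.trans (mul_neg _ _).symm⟩

theorem exists_monomial_eq_ι_mul_ι_mul {S : Finset (Fin n)} {s t : Fin n} (hs : s ∈ S)
    (ht : t ∈ S) (hst : s ≠ t) : ∃ y, monomial e S = ι R (e s) * (ι R (e t) * y) := by
  have h₁ := List.perm_cons_erase ((Finset.mem_sort (· ≤ ·)).2 hs)
  have ht' : t ∈ (S.sort (· ≤ ·)).erase s :=
    (List.mem_erase_of_ne hst.symm).2 ((Finset.mem_sort (· ≤ ·)).2 ht)
  have h := listMonomial_perm e (h₁.trans ((List.perm_cons_erase ht').cons s))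
  rw [listMonomial_cons, listMonomial_cons] at h
  rcases h with h | h
  · exact ⟨_, h⟩
  · exact ⟨_, h.trans (by rw [← mul_neg, ← mul_neg])⟩

/-- Since e_s e_t y = (e_s - e_t) e_t y and ∂(e_s - e_t) = 0, the Leibniz rule lets e_s - e_t factor
out of ∂e_S. -/
theorem exists_differential_monomial_eq {S : Finset (Fin n)} {s t : Fin n} (hs : s ∈ S)
    (ht : t ∈ S) (hst : s ≠ t) :
    ∃ y, differential e (monomial e S) = ι R (e s - e t) * y := by
  obtain ⟨y, hy⟩ := exists_monomial_eq_ι_mul_ι_mul e hs ht hst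
  refine ⟨ι R (e s) * differential e y - y, ?_⟩
  have hsq : ι R (e s) * (ι R (e s) * differential e y) = 0 := by
    rw [← mul_assoc, ι_sq_zero, zero_mul]
  have hsw : ι R (e t) * (ι R (e s) * differential e y)
      = -(ι R (e s) * (ι R (e t) * differential e y)) := by
    rw [← mul_assoc, ι_mul_ι_eq_neg, neg_mul, mul_assoc]
  rw [hy, differential_ι_mul, differential_ι_mul, map_sub, sub_mul, mul_sub, mul_sub, mul_sub, hsq,
    hsw]
  abel

/-- Used to absorb e_s into its block, and to see that e_S is a multiple of ∂e_S. -/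
theorem ι_mul_differential_monomial {S : Finset (Fin n)} {s : Fin n} (hs : s ∈ S) :
    ι R (e s) * differential e (monomial e S) = monomial e S := by
  obtain ⟨y, hy⟩ := exists_monomial_eq_ι_mul e hs
  rw [hy, differential_ι_mul, mul_sub, ← mul_assoc, ι_sq_zero, zero_mul, sub_zero]

/-! ### Degrees -/

theorem mul_mem_exteriorPower {x y : ExteriorAlgebra R V} {a b c : ℕ} (hx : x ∈ ⋀[R]^a V)
    (hy : y ∈ ⋀[R]^b V) (h : a + b = c) : x * y ∈ ⋀[R]^c V := by
  subst h
  rw [exteriorPower, pow_add]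
  exact Submodule.mul_mem_mul hx hy

theorem ι_mem_exteriorPower (v : V) : ι R v ∈ ⋀[R]^1 V := by
  rw [exteriorPower, pow_one]
  exact ⟨v, rfl⟩

theorem one_mem_exteriorPower : (1 : ExteriorAlgebra R V) ∈ ⋀[R]^0 V := by
  rw [exteriorPower, pow_zero]
  exact Submodule.one_le.1 le_rfl

theorem mem_exteriorPower_of_eqUpToSign {x y : ExteriorAlgebra R V} {a : ℕ}
    (h : EqUpToSign x y) (hy : y ∈ ⋀[R]^a V) : x ∈ ⋀[R]^a V := by
  rcases h with rfl | rfl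
  · exact hy
  · exact neg_mem hy

theorem listMonomial_mem (l : List (Fin n)) : listMonomial e l ∈ ⋀[R]^l.length V := by
  induction l with
  | nil => exact one_mem_exteriorPower
  | cons i l ih =>
    rw [listMonomial_cons]
    exact mul_mem_exteriorPower (ι_mem_exteriorPower _) ih (by simp [add_comm])

theorem monomial_mem (S : Finset (Fin n)) : monomial e S ∈ ⋀[R]^S.card V := by
  simpa [monomial_eq_listMonomial] using listMonomial_mem e (S.sort (· ≤ ·))

theorem differential_listMonomial_mem (l : List (Fin n)) :
    differential e (listMonomial e l) ∈ ⋀[R]^(l.length - 1) V := by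
  induction l with
  | nil => simp [differential_one]
  | cons i l ih =>
    rw [listMonomial_cons, differential_ι_mul]
    refine sub_mem (listMonomial_mem e l) ?_
    rcases l with _ | ⟨j, l⟩
    · simp [differential_one]
    · exact mul_mem_exteriorPower (ι_mem_exteriorPower _) ih (by simp [add_comm])

theorem differential_monomial_mem (S : Finset (Fin n)) :
    differential e (monomial e S) ∈ ⋀[R]^(S.card - 1) V := by
  simpa [monomial_eq_listMonomial] using differential_listMonomial_mem e (S.sort (· ≤ ·))

/-- Homogeneous elements commute with vectors up to sign. -/
theorem mul_ι_eqUpToSign {a : ℕ} {x : ExteriorAlgebra R V} (hx : x ∈ ⋀[R]^a V) (v : V) :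
    EqUpToSign (x * ι R v) (ι R v * x) := by
  suffices h : x * ι R v = (-1 : R) ^ a • (ι R v * x) by
    rcases neg_one_pow_eq_or R a with h' | h' <;> rw [h'] at h
    · exact Or.inl (by simpa using h)
    · exact Or.inr (by simpa using h)
  rw [exteriorPower] at hx
  induction hx using Submodule.pow_induction_on_left' with
  | algebraMap r => simp [Algebra.commutes]
  | add x y i _ _ hx hy => rw [add_mul, hx, hy, mul_add, smul_add]
  | mem_mul m hm i x _ ih =>
    obtain ⟨w, rfl⟩ := hm
    rw [mul_assoc, ih, mul_smul_comm, ← mul_assoc, ι_mul_ι_eq_neg, pow_succ, mul_smul, neg_mul,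
      mul_assoc, neg_smul, one_smul, smul_neg]

theorem exteriorPower_eq_span (q : ℕ) :
    ⋀[R]^q V = Submodule.span R {x | ∃ S : Finset (Fin n), S.card = q ∧ x = monomial e S} := by
  apply le_antisymm
  · have hr : LinearMap.range (ι R : V →ₗ[R] _) =
        Submodule.span R (Set.range fun i => ι R (e i)) := by
      rw [LinearMap.range_eq_map, ← e.span_eq, Submodule.map_span, ← Set.range_comp]
      rfl
    have hl : ⋀[R]^q V ≤
        Submodule.span R {x | ∃ l : List (Fin n), l.length = q ∧ x = listMonomial e l} := by
      rw [exteriorPower, hr, Submodule.span_pow]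
      apply Submodule.span_mono
      intro x hx
      rw [Set.mem_pow] at hx
      obtain ⟨f, rfl⟩ := hx
      choose g hg using fun i => (f i).2
      refine ⟨List.ofFn g, by simp, ?_⟩
      rw [listMonomial, List.map_ofFn]
      congr 2
      funext i
      exact (hg i).symm
    refine hl.trans (Submodule.span_le.2 ?_)
    rintro x ⟨l, hl, rfl⟩
    by_cases hd : l.Nodup
    · have h := monomial_toFinset e hd
      have hm : monomial e l.toFinset ∈ Submodule.span R
          {x | ∃ S : Finset (Fin n), S.card = q ∧ x = monomial e S} :=
        Submodule.subset_span ⟨_, by rw [List.toFinset_card_of_nodup hd, hl], rfl⟩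
      rcases h.symm with h | h <;> rw [h]
      · exact hm
      · exact neg_mem hm
    · rw [List.nodup_iff_forall_not_duplicate] at hd
      push Not at hd
      obtain ⟨i, hi⟩ := hd
      rw [List.duplicate_iff_sublist] at hi
      -- A repeated index can be moved to the front twice, up to sign, and e_i² = 0.
      obtain ⟨l', hl'⟩ := hi.exists_perm_append
      have h := (listMonomial_perm e hl').eq_zero (by
        rw [listMonomial_append, listMonomial_cons, listMonomial_cons, ← mul_assoc, ι_sq_zero,
          zero_mul, zero_mul])
      rw [h]
      exact zero_mem _
  · rw [Submodule.span_le]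
    rintro x ⟨S, rfl, rfl⟩
    exact monomial_mem e S

/-! ### The top degree and the pairing -/

/-- The coefficient of the top monomial. -/
noncomputable def topCoeff : ExteriorAlgebra R V →ₗ[R] R :=
  liftAlternating fun i => if h : i = n then h ▸ e.det else 0

theorem topCoeff_monomial_univ : topCoeff e (monomial e Finset.univ) = 1 := by
  have h : monomial e Finset.univ = ιMulti R n e := by
    rw [monomial_eq_listMonomial, Fin.sort_univ, listMonomial, ιMulti_apply, ← List.ofFn_id,
      List.map_ofFn]
    rfl
  rw [h, topCoeff, liftAlternating_apply_ιMulti]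
  simp [Module.Basis.det_self]

theorem eq_topCoeff_smul {x : ExteriorAlgebra R V} (hx : x ∈ ⋀[R]^n V) :
    x = topCoeff e x • monomial e Finset.univ := by
  rw [exteriorPower_eq_span e] at hx
  induction hx using Submodule.span_induction with
  | mem x h =>
    obtain ⟨S, hS, rfl⟩ := h
    obtain rfl : S = Finset.univ := by
      rw [← Finset.card_eq_iff_eq_univ]; simpa using hS
    rw [topCoeff_monomial_univ, one_smul]
  | zero => simp
  | add x y _ _ hx hy => rw [map_add, add_smul, ← hx, ← hy]
  | smul r x _ hx => rw [map_smul, smul_eq_mul, mul_smul, ← hx]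

theorem monomial_mul_monomial_of_not_disjoint {S T : Finset (Fin n)} (h : ¬ Disjoint S T) :
    monomial e S * monomial e T = 0 := by
  obtain ⟨i, hS, hT⟩ := Finset.not_disjoint_iff.1 h
  obtain ⟨x, hx⟩ := exists_monomial_eq_ι_mul e hS
  obtain ⟨y, hy⟩ := exists_monomial_eq_ι_mul e hT
  rw [hx, hy, ← mul_assoc, ι_mul_mul_ι_eq_zero, zero_mul]

theorem monomial_mul_monomial_of_disjoint {S T : Finset (Fin n)} (h : Disjoint S T) :
    EqUpToSign (monomial e S * monomial e T) (monomial e (S ∪ T)) := by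
  rw [monomial_eq_listMonomial, monomial_eq_listMonomial, ← listMonomial_append]
  apply listMonomial_perm
  rw [List.perm_ext_iff_of_nodup _ (Finset.sort_nodup _ _)]
  · simp
  · rw [List.nodup_append]
    refine ⟨Finset.sort_nodup _ _, Finset.sort_nodup _ _, ?_⟩
    simp only [Finset.mem_sort]
    intro a ha b hb hab
    exact Finset.disjoint_left.1 h ha (hab ▸ hb)

/-- The pairing of complementary degrees is nondegenerate. -/
theorem eq_zero_of_forall_mul_monomial {p : ℕ} (hp : p ≤ n) {c : ExteriorAlgebra R V}
    (hc : c ∈ ⋀[R]^(n - p) V)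
    (h : ∀ S : Finset (Fin n), S.card = p → c * monomial e S = 0) : c = 0 := by
  have hr : {x | ∃ S : Finset (Fin n), S.card = n - p ∧ x = monomial e S} =
      Set.range fun S : {S : Finset (Fin n) // S.card = n - p} => monomial e S.1 := by
    ext x
    constructor
    · rintro ⟨S, hS, rfl⟩
      exact ⟨⟨S, hS⟩, rfl⟩
    · rintro ⟨⟨S, hS⟩, rfl⟩
      exact ⟨S, hS, rfl⟩
  rw [exteriorPower_eq_span e, hr, Submodule.mem_span_range_iff_exists_fun] at hc
  obtain ⟨r, rfl⟩ := hc
  apply Finset.sum_eq_zero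
  rintro ⟨U, hU⟩ -
  -- Pairing with the complement of U isolates the coefficient at U: any other set of the same size
  -- meets Uᶜ.
  have h' := h Uᶜ (by rw [Finset.card_compl, hU, Fintype.card_fin]; omega)
  rw [Finset.sum_mul, Finset.sum_eq_single ⟨U, hU⟩] at h'
  · have hm := monomial_mul_monomial_of_disjoint e (disjoint_compl_right (a := U))
    rw [Finset.union_compl] at hm
    have hz : r ⟨U, hU⟩ • monomial e Finset.univ = 0 := by
      rcases hm with hm | hm <;> simpa [hm] using h'
    have hz' := congrArg (topCoeff e) hz
    rw [map_smul, topCoeff_monomial_univ, map_zero, smul_eq_mul, mul_one] at hz'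
    rw [hz', zero_smul]
  · rintro ⟨W, hW⟩ - hne
    rw [smul_mul_assoc, monomial_mul_monomial_of_not_disjoint, smul_zero]
    intro hd
    refine hne (Subtype.ext (Finset.eq_of_subset_of_card_le ?_ (by simp [hU, hW])))
    exact disjoint_compl_right_iff.1 hd
  · simp

end Exterior

/-! ### Matroid combinatorics: layers and transversals -/

section Flag

variable {n : ℕ} {M : Matroid (Fin n)}

/-! ### The flag of an nbc-set -/

/-- Some circuit in D ∪ {x} passes through x, and x is its smallest element. -/
theorem isBrokenCircuit_of_mem_closure {D : Set (Fin n)} {x : Fin n} (hx : x ∈ M.closure D)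
    (hlt : ∀ d ∈ D, x < d) : ∃ B, IsBrokenCircuit M B ∧ B ⊆ D := by
  obtain ⟨C, hCD, hC, hxC⟩ :=
    Matroid.exists_isCircuit_of_mem_closure hx fun h => lt_irrefl _ (hlt x h)
  refine ⟨C \ {x}, ⟨C, x, hC, ⟨hxC, ?_⟩, rfl⟩, ?_⟩
  · intro y hy
    rcases hCD hy with rfl | hy
    · exact le_rfl
    · exact (hlt y hy).le
  · rintro y ⟨hy, hyx⟩
    exact (hCD hy).resolve_left hyx

/-- An element of the closure of a subset of an nbc-set is bounded below by some element of this
subset. -/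
theorem IsNBC.not_forall_lt {T : Finset (Fin n)} (hT : IsNBC M T) {D : Set (Fin n)}
    (hD : D ⊆ T) {x : Fin n} (hx : x ∈ M.closure D) : ¬ ∀ d ∈ D, x < d := by
  intro h
  obtain ⟨B, hB, hBD⟩ := isBrokenCircuit_of_mem_closure hx h
  exact hT B hB (hBD.trans hD)

theorem IsNBC.indep (hE : M.E = Set.univ) {T : Finset (Fin n)} (hT : IsNBC M T) :
    M.Indep (T : Set (Fin n)) := by
  by_contra h
  obtain ⟨C, hCT, hC⟩ := Matroid.Dep.exists_isCircuit_subset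
    ((Matroid.not_indep_iff (by rw [hE]; exact Set.subset_univ _)).1 h)
  obtain ⟨i, hi, hi'⟩ := Set.exists_min_image C id C.toFinite hC.nonempty
  exact hT _ ⟨C, i, hC, ⟨hi, hi'⟩, rfl⟩ (Set.sdiff_subset.trans hCT)

/-- The last `k` elements of `T`. -/
def lastElements (T : Finset (Fin n)) (k : ℕ) : Set (Fin n) :=
  {i | i ∈ (T.sort (· ≤ ·)).drop (T.card - k)}

theorem flagFlat_eq (T : Finset (Fin n)) (k : ℕ) :
    flagFlat M T k = M.closure (lastElements T k) := rfl

theorem lastElements_zero (T : Finset (Fin n)) : lastElements T 0 = ∅ := by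
  ext i
  simp [lastElements, List.drop_eq_nil_of_le]

theorem lastElements_card (T : Finset (Fin n)) : lastElements T T.card = T := by
  ext i
  simp [lastElements]

theorem length_sort_sub_lt (T : Finset (Fin n)) {k : ℕ} (hk : k < T.card) :
    T.card - (k + 1) < (T.sort (· ≤ ·)).length := by
  rw [Finset.length_sort]
  omega

theorem lastElements_succ (T : Finset (Fin n)) {k : ℕ} (hk : k < T.card) :
    lastElements T (k + 1) =
      insert ((T.sort (· ≤ ·))[T.card - (k + 1)]'(length_sort_sub_lt T hk)) (lastElements T k) := by
  have hd := List.drop_eq_getElem_cons (length_sort_sub_lt T hk)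
  rw [show T.card - (k + 1) + 1 = T.card - k by omega] at hd
  ext i
  simp only [lastElements, Set.mem_ofPred_eq, hd, List.mem_cons, Set.mem_insert_iff]

theorem getElem_sort_lt_lastElements (T : Finset (Fin n)) {k : ℕ} (hk : k < T.card) :
    ∀ d ∈ lastElements T k, (T.sort (· ≤ ·))[T.card - (k + 1)]'(length_sort_sub_lt T hk) < d := by
  have hd := List.drop_eq_getElem_cons (length_sort_sub_lt T hk)
  rw [show T.card - (k + 1) + 1 = T.card - k by omega] at hd
  have hs := T.sortedLT_sort.pairwise.sublist
    (List.drop_sublist (T.card - (k + 1)) (T.sort (· ≤ ·)))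
  rw [hd] at hs
  exact fun d h => (List.pairwise_cons.1 hs).1 d h

theorem lastElements_mono (T : Finset (Fin n)) : Monotone (lastElements T) := by
  intro k l hkl i hi
  simp only [lastElements, Set.mem_ofPred_eq] at hi ⊢
  exact (List.drop_sublist_drop_left _ (by omega)).subset hi

theorem lastElements_subset (T : Finset (Fin n)) (k : ℕ) : lastElements T k ⊆ T := by
  intro i hi
  exact (Finset.mem_sort (· ≤ ·)).1 (List.mem_of_mem_drop hi)

theorem flagFlat_mono (T : Finset (Fin n)) : Monotone (flagFlat M T) :=
  fun _ _ h => M.closure_subset_closure (lastElements_mono T h)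

theorem flagFlat_zero (hE : M.E = Set.univ) (hM : IsSimple M) (T : Finset (Fin n)) :
    flagFlat M T 0 = ∅ := by
  rw [flagFlat_eq, lastElements_zero, Set.eq_empty_iff_forall_notMem]
  intro i hi
  have h := hM i (by simp [hE]) i (by simp [hE])
  rw [Set.pair_eq_singleton] at h
  exact (Matroid.indep_singleton.1 h).not_isLoop hi

/-- With zero-based indexing, the entry at p - (k+1) is i_{p-k}, the element adjoined in passing
from X_k to X_{k+1}; independence of T keeps it out of X_k. -/
theorem IsNBC.getElem_sort_mem_layer (hE : M.E = Set.univ) {T : Finset (Fin n)} (hT : IsNBC M T)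
    {k : ℕ} (hk : k < T.card) :
    (T.sort (· ≤ ·))[T.card - (k + 1)]'(length_sort_sub_lt T hk) ∈
      flagFlat M T (k + 1) \ flagFlat M T k := by
  have hi := lastElements_succ T hk
  have hI := (hT.indep hE).subset (lastElements_subset T (k + 1))
  constructor
  · rw [flagFlat_eq, hi]
    exact M.mem_closure_of_mem (Set.mem_insert _ _) (by rw [hE]; exact Set.subset_univ _)
  · rw [hi] at hI
    exact ((hI.subset (Set.subset_insert _ _)).notMem_closure_iff_of_notMem
      (fun h => lt_irrefl _ (getElem_sort_lt_lastElements T hk _ h)) (by rw [hE]; trivial)).2 hI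

/-- A set that meets every layer of the flag in at most one element is independent. -/
theorem indep_of_injOn_layers (hE : M.E = Set.univ) (hM : IsSimple M) (T S : Finset (Fin n))
    (hS : ∀ k < T.card, ∀ s ∈ S, ∀ t ∈ S, s ∈ flagFlat M T (k + 1) \ flagFlat M T k →
      t ∈ flagFlat M T (k + 1) \ flagFlat M T k → s = t)
    (hS' : ∀ s ∈ S, ∀ t ∈ S, s ∉ flagFlat M T T.card → t ∉ flagFlat M T T.card → s = t) :
    M.Indep (S : Set (Fin n)) := by
  -- Adjoining one element outside a flat F to an independent subset of F preserves independence.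
  have step : ∀ (F Y : Set (Fin n)), M.closure F = F → M.Indep ((S : Set (Fin n)) ∩ F) →
      (∀ s ∈ S, ∀ t ∈ S, s ∈ Y \ F → t ∈ Y \ F → s = t) →
      M.Indep ((S : Set (Fin n)) ∩ Y) := by
    intro F Y hF hi hu
    by_cases hne : ∃ s ∈ S, s ∈ Y \ F
    · obtain ⟨s, hs, hsY⟩ := hne
      have hsF : s ∉ M.closure ((S : Set (Fin n)) ∩ F) := fun h =>
        hsY.2 (hF ▸ M.closure_subset_closure Set.inter_subset_right h)
      refine (hi.insert_indep_iff.2 (Or.inl ⟨by rw [hE]; trivial, hsF⟩)).subset ?_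
      rintro t ⟨ht, htY⟩
      by_cases htF : t ∈ F
      · exact Or.inr ⟨ht, htF⟩
      · exact Or.inl (hu t ht s hs ⟨htY, htF⟩ hsY)
    · push Not at hne
      refine hi.subset ?_
      rintro t ⟨ht, htY⟩
      by_contra h
      exact hne t ht ⟨htY, fun h' => h ⟨ht, h'⟩⟩
  have hk : ∀ k ≤ T.card, M.Indep ((S : Set (Fin n)) ∩ flagFlat M T k) := by
    intro k
    induction k with
    | zero => intro _; rw [flagFlat_zero hE hM, Set.inter_empty]; exact M.empty_indep
    | succ k ih =>
      exact fun h => step _ _ (M.closure_closure _) (ih (by omega)) (hS k (by omega))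
  -- The complement of X_p acts as one further layer.
  have := step (flagFlat M T T.card) Set.univ (M.closure_closure _) (hk _ le_rfl)
    fun s hs t ht h h' => hS' s hs t ht h.2 h'.2
  rwa [Set.inter_univ] at this

/-- An nbc-set which is a transversal of the layers of the flag of the nbc-set `T` is `T` itself. -/
theorem IsNBC.eq_of_transversal (hE : M.E = Set.univ) (hM : IsSimple M) {T U : Finset (Fin n)}
    (hT : IsNBC M T) (hU : IsNBC M U) (hc : U.card = T.card)
    (hS : ∀ k < T.card, ∀ s ∈ U, ∀ t ∈ U, s ∈ flagFlat M T (k + 1) \ flagFlat M T k →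
      t ∈ flagFlat M T (k + 1) \ flagFlat M T k → s = t)
    (hS' : ∀ s ∈ U, s ∈ flagFlat M T T.card) : U = T := by
  classical
  have hcard : ∀ k < T.card, (U.filter (· ∈ flagFlat M T (k + 1))).card ≤
      (U.filter (· ∈ flagFlat M T k)).card + 1 := by
    intro k hk
    have h1 : (U.filter (· ∈ flagFlat M T (k + 1) \ flagFlat M T k)).card ≤ 1 := by
      rw [Finset.card_le_one]
      intro a ha b hb
      rw [Finset.mem_filter] at ha hb
      exact hS k hk a ha.1 b hb.1 ha.2 hb.2
    refine (Finset.card_le_card (t := U.filter (· ∈ flagFlat M T k) ∪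
      U.filter (· ∈ flagFlat M T (k + 1) \ flagFlat M T k)) ?_).trans
      ((Finset.card_union_le _ _).trans (by omega))
    intro a ha
    simp only [Finset.mem_union, Finset.mem_filter, Set.mem_sdiff] at ha ⊢
    tauto
  -- Descending from |U ∩ X_p| = p and losing at most one element per layer gives |U ∩ X_k| ≥ k, so
  -- no layer is missed.
  have hlow : ∀ j, j ≤ T.card → T.card - j ≤ (U.filter (· ∈ flagFlat M T (T.card - j))).card := by
    intro j
    induction j with
    | zero =>
      intro _
      rw [Nat.sub_zero, Finset.filter_true_of_mem hS', hc]
    | succ j ih =>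
      intro hj
      have h := hcard (T.card - (j + 1)) (by omega)
      rw [show T.card - (j + 1) + 1 = T.card - j by omega] at h
      have := ih (by omega)
      omega
  have key : ∀ k ≤ T.card, ((U : Set (Fin n)) ∩ flagFlat M T k) = lastElements T k := by
    intro k
    induction k with
    | zero => intro _; rw [flagFlat_zero hE hM, lastElements_zero, Set.inter_empty]
    | succ k ih =>
      intro hk
      have ih := ih (by omega)
      obtain ⟨m, hins, hlt⟩ : ∃ m, lastElements T (k + 1) = insert m (lastElements T k) ∧
          ∀ d ∈ lastElements T k, m < d :=
        ⟨_, lastElements_succ T hk, getElem_sort_lt_lastElements T hk⟩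
      have hmono : flagFlat M T k ⊆ flagFlat M T (k + 1) := flagFlat_mono T (Nat.le_succ k)
      have hex : ∃ j ∈ U, j ∈ flagFlat M T (k + 1) \ flagFlat M T k := by
        by_contra hne
        push Not at hne
        have hl := hlow (T.card - (k + 1)) (by omega)
        rw [show T.card - (T.card - (k + 1)) = k + 1 by omega] at hl
        have hsub : ((U.filter (· ∈ flagFlat M T (k + 1)) : Finset (Fin n)) : Set (Fin n)) ⊆
            lastElements T k := by
          rw [← ih]
          intro a ha
          rw [Finset.coe_filter] at ha
          by_contra hn
          exact hne a ha.1 ⟨ha.2, fun h => hn ⟨ha.1, h⟩⟩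
        have hle : (U.filter (· ∈ flagFlat M T (k + 1))).card ≤ k := by
          have h2 : U.filter (· ∈ flagFlat M T (k + 1)) ⊆
              ((T.sort (· ≤ ·)).drop (T.card - k)).toFinset := by
            intro a ha
            rw [List.mem_toFinset]
            exact hsub ha
          refine (Finset.card_le_card h2).trans ((List.toFinset_card_le _).trans ?_)
          simp
          omega
        omega
      obtain ⟨j, hjU, hj, hj'⟩ := hex
      -- Let j be the element of U, and m that of T, in this layer. If j < m, then j lies below a
      -- subset of T whose closure contains it, contradicting nbc for T. If m < j, exchange puts m
      -- in the closure of a subset of U lying above it, contradicting nbc for U.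
      have hjm : j = m := by
        rcases lt_trichotomy j m with h | h | h
        · refine absurd ?_ (hT.not_forall_lt (lastElements_subset T (k + 1)) hj)
          intro d hd
          rw [hins] at hd
          rcases hd with rfl | hd
          · exact h
          · exact h.trans (hlt d hd)
        · exact h
        · have hmc : m ∈ M.closure (insert j (lastElements T k)) := by
            rw [flagFlat_eq, hins] at hj
            exact Matroid.mem_closure_insert hj' hj
          refine absurd ?_ (hU.not_forall_lt (D := insert j (lastElements T k)) ?_ hmc)
          · rintro d (rfl | hd)
            · exact h
            · exact hlt d hd
          · refine Set.insert_subset hjU ?_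
            rw [← ih]
            exact Set.inter_subset_left
      subst hjm
      rw [hins, ← ih]
      ext a
      constructor
      · rintro ⟨ha, ha'⟩
        by_cases hak : a ∈ flagFlat M T k
        · exact Or.inr ⟨ha, hak⟩
        · exact Or.inl (hS k (by omega) a ha j hjU ⟨ha', hak⟩ ⟨hj, hj'⟩)
      · rintro (rfl | ⟨ha, ha'⟩)
        · exact ⟨hjU, hj⟩
        · exact ⟨ha, hmono ha'⟩
  have := key T.card le_rfl
  rw [lastElements_card] at this
  rw [← Finset.coe_inj, ← this]
  exact (Set.inter_eq_left.2 hS').symm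

end Flag

/-! ### Block products, the pairing, and straightening -/

section Blocks

variable {R : Type*} [CommRing R] {V : Type*} [AddCommGroup V] [Module R V] {n : ℕ}
variable (e : Module.Basis (Fin n) R V)

/-! ### Products of differentials of blocks -/

/-- The product `∂(e_{A_1}) ⋯ ∂(e_{A_k})`. -/
noncomputable def blockProd (L : List (Finset (Fin n))) : ExteriorAlgebra R V :=
  (L.map fun A => differential e (monomial e A)).prod

@[simp]
theorem blockProd_nil : blockProd e [] = 1 := rfl

@[simp]
theorem blockProd_cons (A : Finset (Fin n)) (L : List (Finset (Fin n))) :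
    blockProd e (A :: L) = differential e (monomial e A) * blockProd e L := by
  simp [blockProd]

theorem zBlocks_eqUpToSign (L : List (Finset (Fin n))) :
    EqUpToSign (zBlocks e L) (blockProd e L * monomial e (remainder L)) := by
  unfold zBlocks
  rcases Int.units_eq_one_or (Equiv.Perm.sign (shuffle L)) with h | h <;> rw [h]
  · exact Or.inl (by simp [blockProd])
  · exact Or.inr (by simp [blockProd])

theorem exists_blockProd_mem (L : List (Finset (Fin n))) :
    ∃ a, blockProd e L ∈ ⋀[R]^a V := by
  induction L with
  | nil => exact ⟨0, one_mem_exteriorPower⟩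
  | cons A L ih =>
    obtain ⟨a, ha⟩ := ih
    rw [blockProd_cons]
    exact ⟨_, mul_mem_exteriorPower (differential_monomial_mem e A) ha rfl⟩

theorem length_le_sum_card {L : List (Finset (Fin n))} (hL : ∀ A ∈ L, A.Nonempty) :
    L.length ≤ (L.map Finset.card).sum := by
  rw [← L.length_map Finset.card]
  refine List.length_le_sum_of_one_le _ fun i hi => ?_
  obtain ⟨A, hA, rfl⟩ := List.mem_map.1 hi
  exact (hL A hA).card_pos

/-- Each factor has degree |A| - 1. Nonemptiness keeps the truncated subtraction honest, and the
degree is stated additively for the same reason. -/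
theorem blockProd_mem (L : List (Finset (Fin n))) (hL : ∀ A ∈ L, A.Nonempty) {a : ℕ}
    (ha : a + L.length = (L.map Finset.card).sum) : blockProd e L ∈ ⋀[R]^a V := by
  induction L generalizing a with
  | nil =>
    obtain rfl : a = 0 := by simpa using ha
    exact one_mem_exteriorPower
  | cons A L ih =>
    rw [blockProd_cons]
    have hA := (hL A (by simp)).card_pos
    have hL' := length_le_sum_card (L := L) fun B hB => hL B (by simp [hB])
    simp only [List.length_cons, List.map_cons, List.sum_cons] at ha
    exact mul_mem_exteriorPower (differential_monomial_mem e A)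
      (ih (fun B hB => hL B (by simp [hB])) (a := (L.map Finset.card).sum - L.length) (by omega))
      (by omega)

/-- The factor ∂e_A is divisible by v = e_s - e_t, and v y v = 0 for every y. -/
theorem zBlocks_mul_ι_sub {L : List (Finset (Fin n))} {A : Finset (Fin n)} (hA : A ∈ L)
    {s t : Fin n} (hs : s ∈ A) (ht : t ∈ A) : zBlocks e L * ι R (e s - e t) = 0 := by
  rcases eq_or_ne s t with rfl | hst
  · simp
  refine ((zBlocks_eqUpToSign e L).mul (.refl _)).eq_zero ?_
  obtain ⟨L₁, L₂, rfl⟩ := List.append_of_mem hA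
  obtain ⟨y, hy⟩ := exists_differential_monomial_eq e hs ht hst
  have h : blockProd e (L₁ ++ A :: L₂) =
      blockProd e L₁ * (differential e (monomial e A) * blockProd e L₂) := by
    simp [blockProd]
  rw [h, mul_assoc, mul_assoc, mul_assoc, hy, mul_assoc, ← mul_assoc y, ← mul_assoc (y * _),
    ← mul_assoc (ι R _), ι_mul_mul_ι_eq_zero, mul_zero]

theorem zBlocks_mul_ι {L : List (Finset (Fin n))} {s : Fin n} (hs : s ∈ remainder L) :
    zBlocks e L * ι R (e s) = 0 := by
  refine ((zBlocks_eqUpToSign e L).mul (.refl _)).eq_zero ?_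
  obtain ⟨y, hy⟩ := exists_monomial_eq_ι_mul e hs
  rw [hy, mul_assoc, ι_mul_mul_ι_eq_zero, mul_zero]

theorem zBlocks_mul_ι_sub_of_mem_remainder {L : List (Finset (Fin n))} {s t : Fin n}
    (hs : s ∈ remainder L) (ht : t ∈ remainder L) : zBlocks e L * ι R (e s - e t) = 0 := by
  rw [map_sub, mul_sub, zBlocks_mul_ι e hs, zBlocks_mul_ι e ht, sub_zero]

theorem mul_mul_differential_monomial_eq_zero {x : ExteriorAlgebra R V} {S : Finset (Fin n)}
    {s t : Fin n} (hs : s ∈ S) (ht : t ∈ S) (hst : s ≠ t) (hx : x * ι R (e s - e t) = 0)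
    (y : ExteriorAlgebra R V) : x * y * differential e (monomial e S) = 0 := by
  obtain ⟨w, hw⟩ := exists_differential_monomial_eq e hs ht hst
  rw [hw, ← mul_assoc, mul_mul_ι_eq_zero hx, zero_mul]

theorem mul_monomial_eq_zero {x : ExteriorAlgebra R V} {S : Finset (Fin n)}
    {s t : Fin n} (hs : s ∈ S) (ht : t ∈ S) (hst : s ≠ t) (hx : x * ι R (e s - e t) = 0) :
    x * monomial e S = 0 := by
  rw [← ι_mul_differential_monomial e hs, ← mul_assoc]
  exact mul_mul_differential_monomial_eq_zero e hs ht hst hx _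

/-- Each e_i moves left, up to sign, to the block containing i and turns ∂e_A into e_A. The
homogeneous x, later the monomial of the remainder, is only carried along. -/
theorem blockProd_mul_listMonomial {t : List (Fin n)} {L : List (Finset (Fin n))}
    (h : List.Forall₂ (fun i A => i ∈ A) t L) {b : ℕ} {x : ExteriorAlgebra R V}
    (hx : x ∈ ⋀[R]^b V) :
    EqUpToSign (blockProd e L * x * listMonomial e t)
      (listMonomial e (L.flatMap fun A => A.sort (· ≤ ·)) * x) := by
  induction h with
  | nil => simpa using EqUpToSign.refl _
  | @cons i A t L hi _ ih =>
    obtain ⟨a, ha⟩ := exists_blockProd_mem e L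
    have h₁ := mul_ι_eqUpToSign (mul_mem_exteriorPower ha hx rfl) (e i)
    have h₂ := mul_ι_eqUpToSign (differential_monomial_mem e A) (e i)
    rw [ι_mul_differential_monomial e hi] at h₂
    rw [blockProd_cons, listMonomial_cons, List.flatMap_cons, listMonomial_append,
      mul_assoc (listMonomial e _), ← monomial_eq_listMonomial]
    refine .trans ?_ (h₂.mul ih)
    have h₃ := ((EqUpToSign.refl (differential e (monomial e A))).mul h₁).mul
      (.refl (listMonomial e t))
    simpa only [mul_assoc] using h₃

theorem flatMap_sort_append_perm {L : List (Finset (Fin n))} (hL : L.Pairwise Disjoint) :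
    ((L.flatMap fun A => A.sort (· ≤ ·)) ++ (remainder L).sort (· ≤ ·)).Perm
      ((Finset.univ : Finset (Fin n)).sort (· ≤ ·)) := by
  rw [List.perm_ext_iff_of_nodup _ (Finset.sort_nodup _ _)]
  · intro i
    simp only [List.mem_append, List.mem_flatMap, Finset.mem_sort, remainder, Finset.mem_filter,
      Finset.mem_univ, true_and, iff_true]
    by_cases h : ∃ A ∈ L, i ∈ A
    · exact Or.inl h
    · push Not at h
      exact Or.inr h
  · rw [List.nodup_append]
    refine ⟨?_, Finset.sort_nodup _ _, ?_⟩
    · rw [List.nodup_flatMap]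
      refine ⟨fun A _ => Finset.sort_nodup _ _, hL.imp ?_⟩
      intro A B hAB i hA hB
      exact Finset.disjoint_left.1 hAB ((Finset.mem_sort (· ≤ ·)).1 hA)
        ((Finset.mem_sort (· ≤ ·)).1 hB)
    · rintro a ha b hb rfl
      obtain ⟨A, hA, ha⟩ := List.mem_flatMap.1 ha
      rw [Finset.mem_sort] at ha hb
      exact (Finset.mem_filter.1 hb).2 A hA ha

theorem zBlocks_mem {L : List (Finset (Fin n))} (hL : L.Pairwise Disjoint)
    (hL' : ∀ A ∈ L, A.Nonempty) : zBlocks e L ∈ ⋀[R]^(n - L.length) V := by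
  refine mem_exteriorPower_of_eqUpToSign (zBlocks_eqUpToSign e L) ?_
  have hlen := (flatMap_sort_append_perm hL).length_eq
  simp only [List.length_append, List.length_flatMap, Finset.length_sort, Finset.card_univ,
    Fintype.card_fin] at hlen
  have hle := length_le_sum_card hL'
  have hlen' : (L.map Finset.card).sum + (remainder L).card = n := hlen
  exact mul_mem_exteriorPower
    (blockProd_mem e L hL' (a := (L.map Finset.card).sum - L.length) (by omega))
    (monomial_mem e _) (by omega)

theorem zBlocks_mul_listMonomial {L : List (Finset (Fin n))} (hL : L.Pairwise Disjoint)
    {t : List (Fin n)} (ht : List.Forall₂ (fun i A => i ∈ A) t L) :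
    EqUpToSign (zBlocks e L * listMonomial e t) (monomial e Finset.univ) := by
  refine ((zBlocks_eqUpToSign e L).mul (.refl _)).trans
    ((blockProd_mul_listMonomial e ht (monomial_mem e _)).trans ?_)
  rw [monomial_eq_listMonomial, ← listMonomial_append]
  exact listMonomial_perm e (flatMap_sort_append_perm hL)

/-! ### The elements `z(T)` -/

variable {M : Matroid (Fin n)}

theorem mem_flagBlocks {T A : Finset (Fin n)} : A ∈ flagBlocks M T ↔
    ∃ k < T.card, ∀ i, i ∈ A ↔ i ∈ flagFlat M T (k + 1) \ flagFlat M T k := by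
  simp only [flagBlocks, List.mem_map, List.mem_range]
  refine exists_congr fun k => and_congr_right fun _ => ?_
  rw [Finset.ext_iff]
  exact forall_congr' fun i => by simp [iff_comm]

theorem exists_mem_flagBlocks (T : Finset (Fin n)) {k : ℕ} (hk : k < T.card) :
    ∃ A ∈ flagBlocks M T, ∀ i, i ∈ A ↔ i ∈ flagFlat M T (k + 1) \ flagFlat M T k := by
  classical
  have h : ∀ i, i ∈ Finset.univ.filter (· ∈ flagFlat M T (k + 1) \ flagFlat M T k) ↔
      i ∈ flagFlat M T (k + 1) \ flagFlat M T k := by simp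
  exact ⟨_, mem_flagBlocks.2 ⟨k, hk, h⟩, h⟩

theorem mem_remainder_flagBlocks {T : Finset (Fin n)} {i : Fin n}
    (hi : i ∉ flagFlat M T T.card) : i ∈ remainder (flagBlocks M T) := by
  simp only [remainder, Finset.mem_filter, Finset.mem_univ, true_and]
  intro A hA hiA
  obtain ⟨k, hk, h⟩ := mem_flagBlocks.1 hA
  exact hi (flagFlat_mono T hk ((h i).1 hiA).1)

theorem pairwise_disjoint_flagBlocks (T : Finset (Fin n)) :
    (flagBlocks M T).Pairwise Disjoint := by
  rw [flagBlocks, List.pairwise_map]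
  refine List.pairwise_lt_range.imp ?_
  intro k l hkl
  rw [Finset.disjoint_left]
  intro i hi hi'
  simp only [Finset.mem_filter, Finset.mem_univ, true_and] at hi hi'
  exact hi'.2 (flagFlat_mono T hkl hi.1)

theorem z_mul_ι_sub {T : Finset (Fin n)} {k : ℕ} (hk : k < T.card) {s t : Fin n}
    (hs : s ∈ flagFlat M T (k + 1) \ flagFlat M T k)
    (ht : t ∈ flagFlat M T (k + 1) \ flagFlat M T k) : z e M T * ι R (e s - e t) = 0 := by
  obtain ⟨A, hA, h⟩ := exists_mem_flagBlocks (M := M) T hk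
  exact zBlocks_mul_ι_sub e hA ((h s).2 hs) ((h t).2 ht)

theorem z_mul_eq_zero_of_mem_ideal (hE : M.E = Set.univ) (hM : IsSimple M) (T : Finset (Fin n))
    {b : ExteriorAlgebra R V} (hb : b ∈ ideal e M) : z e M T * b = 0 := by
  -- The ideal is two-sided, so an arbitrary middle factor y is needed to absorb left multiples in
  -- the induction.
  suffices h : ∀ y, z e M T * y * b = 0 by simpa using h 1
  induction hb using TwoSidedIdeal.span_induction with
  | mem x hx =>
    obtain ⟨S, hS, rfl⟩ := hx
    intro y
    by_contra hne
    refine hS.not_indep (indep_of_injOn_layers hE hM T S ?_ ?_)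
    · intro k hk s hs t ht hs' ht'
      by_contra hst
      exact hne (mul_mul_differential_monomial_eq_zero e hs ht hst
        (z_mul_ι_sub e hk hs' ht') y)
    · intro s hs t ht hs' ht'
      by_contra hst
      exact hne (mul_mul_differential_monomial_eq_zero e hs ht hst
        (zBlocks_mul_ι_sub_of_mem_remainder e (mem_remainder_flagBlocks hs')
          (mem_remainder_flagBlocks ht')) y)
  | zero => intro y; rw [mul_zero]
  | add a b _ _ ha hb => intro y; rw [mul_add, ha, hb, add_zero]
  | neg a _ ha => intro y; rw [mul_neg, ha, neg_zero]
  | left_absorb a x _ hx => intro y; rw [← mul_assoc, mul_assoc _ y a, hx]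
  | right_absorb a x _ hx => intro y; rw [← mul_assoc, hx, zero_mul]

theorem z_mem (hE : M.E = Set.univ) {T : Finset (Fin n)} (hT : IsNBC M T) :
    z e M T ∈ ⋀[R]^(n - T.card) V := by
  have h := zBlocks_mem e (pairwise_disjoint_flagBlocks (M := M) T) (by
    intro A hA
    obtain ⟨k, hk, h⟩ := mem_flagBlocks.1 hA
    exact ⟨_, (h _).2 (hT.getElem_sort_mem_layer hE hk)⟩)
  simpa [flagBlocks, z] using h

theorem z_mul_monomial_self (hE : M.E = Set.univ) {T : Finset (Fin n)} (hT : IsNBC M T) :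
    EqUpToSign (z e M T * monomial e T) (monomial e Finset.univ) := by
  -- The flag adjoins the largest elements first, so S_1, ..., S_p match i_p, ..., i_1.
  have h : List.Forall₂ (fun i A => i ∈ A) (T.sort (· ≤ ·)).reverse (flagBlocks M T) := by
    rw [List.forall₂_iff_get]
    refine ⟨by simp [flagBlocks], ?_⟩
    intro k h₁ h₂
    have hk : k < T.card := by simpa using h₁
    have := hT.getElem_sort_mem_layer hE hk
    simp only [flagBlocks, List.get_eq_getElem, List.getElem_map, List.getElem_range,
      Finset.mem_filter, Finset.mem_univ, true_and, List.getElem_reverse, Finset.length_sort]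
    convert this using 2
    omega
  refine .trans (.mul (.refl _) ?_) (zBlocks_mul_listMonomial e (pairwise_disjoint_flagBlocks T) h)
  rw [monomial_eq_listMonomial]
  exact listMonomial_perm e (List.reverse_perm _).symm

theorem z_mul_monomial_of_ne (hE : M.E = Set.univ) (hM : IsSimple M) {T U : Finset (Fin n)}
    (hT : IsNBC M T) (hU : IsNBC M U) (hc : U.card = T.card) (hne : U ≠ T) :
    z e M T * monomial e U = 0 := by
  by_contra h
  refine hne (hT.eq_of_transversal hE hM hU hc ?_ ?_)
  · intro k hk s hs t ht hs' ht'
    by_contra hst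
    exact h (mul_monomial_eq_zero e hs ht hst (z_mul_ι_sub e hk hs' ht'))
  · intro s hs
    by_contra hs'
    obtain ⟨y, hy⟩ := exists_monomial_eq_ι_mul e hs
    apply h
    rw [hy, ← mul_assoc, z, zBlocks_mul_ι e (mem_remainder_flagBlocks hs'), zero_mul]

/-! ### Monomials of nbc-sets span modulo the Orlik-Solomon ideal -/

/-- ∂e_l is a signed sum of the monomials with one factor removed. A general linear f lets the
induction absorb the leading factor into f. -/
theorem map_differential_listMonomial_eq_zero {W : Type*} [AddCommGroup W] [Module R W]
    (f : ExteriorAlgebra R V →ₗ[R] W) (l : List (Fin n)) (hl : l.Nodup)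
    (h : ∀ j ∈ l, f (listMonomial e (l.erase j)) = 0) :
    f (differential e (listMonomial e l)) = 0 := by
  induction l generalizing f with
  | nil => simp [differential_one]
  | cons a l ih =>
    have ha := h a (by simp)
    rw [List.erase_cons_head] at ha
    rw [listMonomial_cons, differential_ι_mul, map_sub, ha, zero_sub, neg_eq_zero]
    refine ih (f ∘ₗ LinearMap.mulLeft R (ι R (e a))) hl.of_cons ?_
    intro j hj
    have hja : a ≠ j := by
      rintro rfl
      exact (List.nodup_cons.1 hl).1 hj
    have := h j (by simp [hj])
    rwa [List.erase_cons_tail (by simpa using hja), listMonomial_cons] at this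

/-- Straightening, by induction on the sum of the elements of S. If S is dependent, e_S ∈ I. If S is
independent and contains a broken circuit B = C \ {i}, then e_B ≡ e_i ∂e_B modulo I, so e_S becomes
a signed sum of monomials of sets in which some j ∈ B is replaced by the smaller i. -/
theorem mul_monomial_eq_zero_of_forall_nbc (hE : M.E = Set.univ) {p : ℕ}
    {c : ExteriorAlgebra R V} (hc : ∀ b ∈ ideal e M, c * b = 0)
    (h : ∀ T : Finset (Fin n), IsNBC M T → T.card = p → c * monomial e T = 0)
    (S : Finset (Fin n)) (hS : S.card = p) : c * monomial e S = 0 := by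
  induction hm : ∑ i ∈ S, (i : ℕ) using Nat.strong_induction_on generalizing S with
  | _ m ih =>
  classical
  by_cases hnbc : IsNBC M S
  · exact h S hnbc hS
  by_cases hI : M.Indep (S : Set (Fin n))
  swap
  · have hne : S.Nonempty := by
      rw [Finset.nonempty_iff_ne_empty]
      rintro rfl
      exact hI (by simp)
    obtain ⟨s, hs⟩ := hne
    refine hc _ ?_
    rw [← ι_mul_differential_monomial e hs]
    refine TwoSidedIdeal.mul_mem_left _ _ _ (TwoSidedIdeal.subset_span ⟨S, ?_, rfl⟩)
    exact ⟨hI, by rw [hE]; exact Set.subset_univ _⟩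
  rw [IsNBC] at hnbc
  push Not at hnbc
  obtain ⟨_, ⟨C, i, hC, hi, rfl⟩, hBS⟩ := hnbc
  have hiS : i ∉ S := by
    intro hiS
    refine hC.not_indep (hI.subset ?_)
    intro j hj
    by_cases hji : j = i
    · exact hji ▸ hiS
    · exact hBS ⟨hj, hji⟩
  obtain ⟨B, hB⟩ : ∃ B : Finset (Fin n), (B : Set (Fin n)) = C \ {i} :=
    ⟨(C \ {i}).toFinite.toFinset, by simp⟩
  have hBS' : B ⊆ S := by
    rw [← Finset.coe_subset, hB]
    exact hBS
  have hiB : i ∉ B := fun h => hiS (hBS' h)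
  have hdep : M.Dep ((insert i B : Finset (Fin n)) : Set (Fin n)) := by
    rw [Finset.coe_insert, hB, Set.insert_sdiff_singleton, Set.insert_eq_of_mem hi.1]
    exact hC.dep
  have hmem : c * differential e (monomial e (insert i B)) = 0 :=
    hc _ (TwoSidedIdeal.subset_span ⟨_, hdep, rfl⟩)
  have hsplit : EqUpToSign (monomial e (insert i B)) (ι R (e i) * monomial e B) := by
    have := monomial_toFinset e (l := i :: B.sort (· ≤ ·))
      (List.nodup_cons.2 ⟨by simpa using hiB, Finset.sort_nodup _ _⟩)
    rwa [List.toFinset_cons, Finset.sort_toFinset, listMonomial_cons] at this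
  -- By Leibniz, e_B - e_i ∂e_B = ∂(e_i e_B) = ±∂e_C, which lies in I.
  have hexch : c * monomial e B = c * (ι R (e i) * differential e (monomial e B)) := by
    rw [← sub_eq_zero, ← mul_sub, ← differential_ι_mul]
    rcases hsplit.symm with h' | h' <;> rw [h']
    · exact hmem
    · rw [map_neg, mul_neg, hmem, neg_zero]
  have hSB := monomial_mul_monomial_of_disjoint e (Finset.disjoint_sdiff (s := B) (t := S))
  rw [Finset.union_sdiff_of_subset hBS'] at hSB
  refine ((EqUpToSign.refl c).mul hSB.symm).eq_zero ?_
  rw [← mul_assoc, hexch]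
  refine map_differential_listMonomial_eq_zero e
    (LinearMap.mulRight R (monomial e (S \ B)) ∘ₗ LinearMap.mulLeft R c ∘ₗ
      LinearMap.mulLeft R (ι R (e i))) (B.sort (· ≤ ·)) (Finset.sort_nodup _ _) ?_
  intro j hj
  rw [Finset.mem_sort] at hj
  have hij : i < j := by
    have hjC : j ∈ C \ {i} := hB ▸ hj
    exact lt_of_le_of_ne (hi.2 hjC.1) fun h => hjC.2 h.symm
  have hjS := hBS' hj
  have hnd : (i :: ((B.sort (· ≤ ·)).erase j ++ (S \ B).sort (· ≤ ·))).Nodup := by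
    rw [List.nodup_cons, List.nodup_append]
    refine ⟨?_, (Finset.sort_nodup _ _).erase _, Finset.sort_nodup _ _, ?_⟩
    · rw [List.mem_append]
      rintro (h' | h')
      · exact hiB ((Finset.mem_sort (· ≤ ·)).1 (List.mem_of_mem_erase h'))
      · exact hiS (Finset.mem_sdiff.1 ((Finset.mem_sort (· ≤ ·)).1 h')).1
    · rintro a ha b hb rfl
      exact (Finset.mem_sdiff.1 ((Finset.mem_sort (· ≤ ·)).1 hb)).2
        ((Finset.mem_sort (· ≤ ·)).1 (List.mem_of_mem_erase ha))
  have hfin : (i :: ((B.sort (· ≤ ·)).erase j ++ (S \ B).sort (· ≤ ·))).toFinset =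
      insert i (S.erase j) := by
    ext a
    have hab : a ∈ B → a ∈ S := fun h => hBS' h
    simp only [List.mem_toFinset, List.mem_cons, List.mem_append, Finset.mem_sort,
      (Finset.sort_nodup B (· ≤ ·)).mem_erase_iff, Finset.mem_sdiff, Finset.mem_insert,
      Finset.mem_erase]
    have : a ∉ B → a ≠ j := by
      rintro h rfl
      exact h hj
    tauto
  have hiE : i ∉ S.erase j := fun h => hiS (Finset.mem_of_mem_erase h)
  have hcard : (insert i (S.erase j)).card = p := by
    rw [Finset.card_insert_of_notMem hiE, Finset.card_erase_of_mem hjS, ← hS]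
    have := Finset.card_pos.2 ⟨j, hjS⟩
    omega
  have hsum : ∑ a ∈ insert i (S.erase j), (a : ℕ) < m := by
    rw [Finset.sum_insert hiE, ← hm, ← Finset.add_sum_erase S _ hjS]
    exact Nat.add_lt_add_right hij _
  have hz := ih _ hsum _ hcard rfl
  have hl := monomial_toFinset e hnd
  rw [hfin, listMonomial_cons, listMonomial_append, ← monomial_eq_listMonomial] at hl
  have := ((EqUpToSign.refl c).mul hl.symm).eq_zero hz
  simpa [mul_assoc] using this

end Blocks

end OrlikSolomon

/-! ### The basis theorem -/

theorem proposition3p9 {R : Type*} [CommRing R] {V : Type*} [AddCommGroup V] [Module R V]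
    {n : ℕ} (e : Module.Basis (Fin n) R V)
    (M : Matroid (Fin n)) (hE : M.E = Set.univ) (hM : OrlikSolomon.IsSimple M)
    (p : ℕ) (hp : p ≤ n) :
    ∃ B : Module.Basis {T : Finset (Fin n) // OrlikSolomon.IsNBC M T ∧ T.card = p} R
        (OrlikSolomon.annihilatorComponent (OrlikSolomon.ideal e M) (n - p)),
      ∀ T, (B T : ExteriorAlgebra R V) = OrlikSolomon.z e M T := by
  classical
  have hmem : ∀ T : {T : Finset (Fin n) // OrlikSolomon.IsNBC M T ∧ T.card = p},
      OrlikSolomon.z e M T ∈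
        OrlikSolomon.annihilatorComponent (OrlikSolomon.ideal e M) (n - p) := by
    rintro ⟨T, hT, rfl⟩
    exact ⟨fun b hb => OrlikSolomon.z_mul_eq_zero_of_mem_ideal e hE hM T hb,
      OrlikSolomon.z_mem e hE hT⟩
  have hoff : ∀ T U : {T : Finset (Fin n) // OrlikSolomon.IsNBC M T ∧ T.card = p}, T ≠ U →
      OrlikSolomon.z e M T * OrlikSolomon.monomial e U.1 = 0 := fun T U hTU =>
    OrlikSolomon.z_mul_monomial_of_ne e hE hM T.2.1 U.2.1 (U.2.2.trans T.2.2.symm)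
      fun h => hTU (Subtype.ext h.symm)
  have hsum : ∀ (r : {T : Finset (Fin n) // OrlikSolomon.IsNBC M T ∧ T.card = p} → R) U,
      (∑ T, r T • OrlikSolomon.z e M T) * OrlikSolomon.monomial e U.1 =
        r U • (OrlikSolomon.z e M U * OrlikSolomon.monomial e U.1) := by
    intro r U
    rw [Finset.sum_mul, Finset.sum_eq_single U, smul_mul_assoc]
    · intro T _ hT
      rw [smul_mul_assoc, hoff T U hT, smul_zero]
    · simp
  have hli : LinearIndependent R fun T : {T : Finset (Fin n) // OrlikSolomon.IsNBC M T ∧ T.card = p} =>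
      (⟨OrlikSolomon.z e M T, hmem T⟩ :
      OrlikSolomon.annihilatorComponent (OrlikSolomon.ideal e M) (n - p)) := by
    rw [Fintype.linearIndependent_iff]
    intro r hr U
    have h := congrArg Subtype.val hr
    simp only [AddSubmonoidClass.coe_finsetSum, SetLike.val_smul, ZeroMemClass.coe_zero] at h
    have hU := hsum r U
    rw [h, zero_mul] at hU
    have hU' := congrArg (OrlikSolomon.topCoeff e) hU
    rcases OrlikSolomon.z_mul_monomial_self e hE U.2.1 with h' | h' <;>
      simpa [h', OrlikSolomon.topCoeff_monomial_univ, eq_comm] using hU'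
  refine ⟨Module.Basis.mk hli ?_, fun T => by rw [Module.Basis.mk_apply]⟩
  rintro ⟨a, ha, hadeg⟩ -
  -- The coordinate at U exists because z(U)e_U = ± the top monomial generates E_n.
  have hexists : ∀ U : {T : Finset (Fin n) // OrlikSolomon.IsNBC M T ∧ T.card = p}, ∃ r : R,
      a * OrlikSolomon.monomial e U.1 =
        r • (OrlikSolomon.z e M U * OrlikSolomon.monomial e U.1) := by
    intro U
    have h := OrlikSolomon.eq_topCoeff_smul e (OrlikSolomon.mul_mem_exteriorPower hadeg
      (OrlikSolomon.monomial_mem e U.1) (by rw [U.2.2]; omega))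
    rcases OrlikSolomon.z_mul_monomial_self e hE U.2.1 with h' | h' <;> rw [h']
    · exact ⟨_, h⟩
    · exact ⟨_, h.trans (neg_smul_neg _ _).symm⟩
  choose r hr using hexists
  rw [Submodule.mem_span_range_iff_exists_fun]
  refine ⟨r, Subtype.ext ?_⟩
  simp only [AddSubmonoidClass.coe_finsetSum, SetLike.val_smul]
  rw [eq_comm, ← sub_eq_zero]
  have hc : a - ∑ T : {T : Finset (Fin n) // OrlikSolomon.IsNBC M T ∧ T.card = p},
      r T • OrlikSolomon.z e M T ∈
      OrlikSolomon.annihilatorComponent (OrlikSolomon.ideal e M) (n - p) :=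
    sub_mem ⟨ha, hadeg⟩ (sum_mem fun T _ => Submodule.smul_mem _ _ (hmem T))
  refine OrlikSolomon.eq_zero_of_forall_mul_monomial e hp hc.2
    (OrlikSolomon.mul_monomial_eq_zero_of_forall_nbc e hE hc.1 ?_)
  intro U hU hUp
  rw [sub_mul, hr ⟨U, hU, hUp⟩, hsum r ⟨U, hU, hUp⟩, sub_self]
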